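/- All graphs are simple and undirected (finite or infinite), and $\mathbb{N}$ contains $0$. Let $\Gamma$ be an abelian group. A $\Gamma$-labelled graph $(G,\gamma)$ is a graph $G$ together with a function $\gamma:E(G)\to\Gamma$. The $\gamma$-value of a path or cycle of $G$ is the sum of $\gamma(e)$ over its edges $e$. For $A\subseteq\Gamma$, the $(\Gamma,A)$-vertex-arboricity $\operatorname{arb}_{(\Gamma,A)}(G,\gamma)$ is the minimum integer $k$ such that $V(G)$ can be partitioned into $k$ parts, each of which induces a subgraph having no cycle of $\gamma$-value in $A$ (and $\infty$ if there is no such $k$, which is possible only for infinite $G$). A subdivision of $K_t$ in $G$ consists of $t$ distinct vertices of $G$ (the branching vertices) together with, for every pair of them, a path of $G$ joining the two (a branching path), such that no branching path contains a branching vertex other than its two ends, and any two different branching paths meet only in branching vertices. It is an $(A,d)$-subdivision of $K_t$ if every branching path has $\gamma$-value in $A$ and length (number of edges) at least $d$. **Theorem 1.1.** For every positive integer $\omega$ there is a function $f_\omega:\mathbb{N}\times\mathbb{N}\to\mathbb{N}$ with the following property. Let $\Gamma$ be an abelian group, let $A\subseteq\Gamma$ be a nonempty set with $|\Gamma\setminus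 A|\le\omega$, let $(G,\gamma)$ be a $\Gamma$-labelled graph, and let $t,d\in\mathbb{N}$. If $\operatorname{arb}_{(\Gamma,A)}(G,\gamma)\ge f_\omega(t,d)$, then $G$ contains an $(A,d)$-subdivision of $K_t$. -/

import Mathlib

namespace LabelledGraph

universe u v

variable {V : Type u} {Γ : Type v} [AddCommGroup Γ] {G : SimpleGraph V}

/-- The `γ`-value of a walk: the sum of the labels of the edges it traverses. For a path or a
cycle, which traverses no edge twice, this is the sum of the labels over its edge set. -/
def value (γ : G.edgeSet → Γ) : {x y : V} → G.Walk x y → Γ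
  | _, _, .nil => 0
  | _, _, .cons (u := a) (v := b) h p => γ ⟨s(a, b), h⟩ + value γ p

/-- The subgraph of `G` induced by `S` has no cycle of `γ`-value in `A`. (A cycle of the induced
subgraph is a cycle of `G` all of whose vertices are in `S`.) -/
def NoCycleIn (γ : G.edgeSet → Γ) (A : Set Γ) (S : Set V) : Prop :=
  ∀ (x : V) (C : G.Walk x x), C.IsCycle → (∀ y ∈ C.support, y ∈ S) → value γ C ∉ A

/-- The vertex set can be partitioned into `k` (possibly empty) parts, the fibres of `c`, each of
which induces a subgraph with no cycle of `γ`-value in `A`. -/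
def ArborablyPartitionable (γ : G.edgeSet → Γ) (A : Set Γ) (k : ℕ) : Prop :=
  ∃ c : V → Fin k, ∀ i : Fin k, NoCycleIn γ A {x | c x = i}

/-- The `(Γ, A)`-vertex-arboricity: the least `k` such that the vertex set can be partitioned
into `k` parts each inducing a subgraph with no cycle of `γ`-value in `A`. It is `⊤` if there is no
such `k`, which can only happen for infinite graphs. -/
noncomputable def arboricity (γ : G.edgeSet → Γ) (A : Set Γ) : ℕ∞ :=
  ⨅ (k : ℕ) (_ : ArborablyPartitionable γ A k), (k : ℕ∞)

/-- A subdivision of `K_t` contained in `G`: distinct branching vertices, and for each pair of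
them a branching path joining them, such that a branching path contains no branching vertices
besides its ends, and two different branching paths meet only in branching vertices. -/
structure CompleteSubdivision (G : SimpleGraph V) (t : ℕ) where
  branch : Fin t → V
  branch_injective : Function.Injective branch
  path : (i j : Fin t) → i < j → G.Walk (branch i) (branch j)
  isPath : ∀ i j h, (path i j h).IsPath
  branch_mem : ∀ i j h k, branch k ∈ (path i j h).support → k = i ∨ k = j
  internally_disjoint : ∀ i j h i' j' h', (i, j) ≠ (i', j') →
    ∀ x, x ∈ (path i j h).support → x ∈ (path i' j' h').support → x ∈ Set.range branch

/-- An `(A, d)`-subdivision: every branching path has `γ`-value in `A` and length at least `d`. -/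
def CompleteSubdivision.IsAd {t : ℕ} (K : CompleteSubdivision G t) (γ : G.edgeSet → Γ)
    (A : Set Γ) (d : ℕ) : Prop :=
  ∀ i j h, value γ (K.path i j h) ∈ A ∧ d ≤ (K.path i j h).length

end LabelledGraph

namespace LabelledGraph
open SimpleGraph
open scoped Pointwise

universe u v
variable {V : Type u} {Γ : Type v} [AddCommGroup Γ]

/-! By compactness (`Part.of_finite`) it suffices to treat a finite vertex set needing many classes.
The core is a linking step (`hasLinkedSet`): such a set `Y` contains a set `X`, still needing many
classes, any two of whose vertices are joined through `Y \ X` by a long path of value in `A`.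
Iterating it `t * t` times gives disjoint regions, each linking all pairs of a final set with at
least `t` vertices; using a separate region for every pair yields the subdivision.

For the linking step, a breadth first layer (`exists_layer`) provides links of uncontrolled value.
Splitting off a piece of the layer and routing the links through it (`Linked.insert_gadget`)
lengthens them, and if the piece has two paths with common ends and values `x`, `y`, the set `S` of
available values becomes `S + {x, y}`. This is larger than `S` unless `x - y` stabilises `S`. More
than `ω` values must meet `A`, so growth succeeds unless some piece is rigid modulo the stabiliser
of `S`, a finite subgroup of order at most `ω`.

The argument is therefore an induction on a subgroup `H` modulo which `Y` is rigid, starting from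
the whole group. Either a piece is rigid modulo a proper subgroup of `H`, or `S` becomes large, or
`H` stabilises `S`. In the last case the values of the links fill whole cosets of `H`, and these
meet `A` by `Rigid.exists_subset_meeting`: in a rigid set path values come from a potential modulo
`H`, and colouring the potentials with `ω + 1` colours avoids cosets missing `A`. -/

/-! ### Values of walks and the basic notions -/

/-- The sum of the labels along a walk, for a labelling of all pairs of vertices. -/
def wt {G : SimpleGraph V} (γ : Sym2 V → Γ) {x y : V} (p : G.Walk x y) : Γ :=
  (p.edges.map γ).sum

section wt
variable {G : SimpleGraph V} (γ : Sym2 V → Γ) {x y z : V}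

@[simp] lemma wt_nil : wt γ (Walk.nil : G.Walk x x) = 0 := by simp [wt]

@[simp] lemma wt_cons (h : G.Adj x y) (p : G.Walk y z) :
    wt γ (Walk.cons h p) = γ s(x, y) + wt γ p := by simp [wt]

@[simp] lemma wt_append (p : G.Walk x y) (q : G.Walk y z) :
    wt γ (p.append q) = wt γ p + wt γ q := by simp [wt]

@[simp] lemma wt_reverse (p : G.Walk x y) : wt γ p.reverse = wt γ p := by
  simp [wt, List.sum_reverse]

@[simp] lemma wt_mapLe {G' : SimpleGraph V} (h : G ≤ G') (p : G.Walk x y) :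
    wt γ (p.mapLe h) = wt γ p := by simp [wt]

@[simp] lemma wt_transfer {G' : SimpleGraph V} (p : G.Walk x y) (h) :
    wt γ (p.transfer G' h) = wt γ p := by simp [wt]

end wt

/-- The set `Y` can be split into `n` classes none of which contains a cycle of value in `A`. -/
def Part (G : SimpleGraph V) (γ : Sym2 V → Γ) (A : Set Γ) (Y : Set V) (n : ℕ) : Prop :=
  ∃ c : V → ℕ, (∀ y ∈ Y, c y < n) ∧ ∀ (x : V) (C : G.Walk x x), C.IsCycle → wt γ C ∈ A →
    (∀ y ∈ C.support, y ∈ Y) → ∃ y ∈ C.support, c y ≠ c x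

/-- There is a path from `u` to `v` inside `Y` of value `g` and length at least `l`. -/
def Route (G : SimpleGraph V) (γ : Sym2 V → Γ) (Y : Set V) (u v : V) (g : Γ) (l : ℕ) : Prop :=
  ∃ p : G.Walk u v, p.IsPath ∧ (∀ x ∈ p.support, x ∈ Y) ∧ wt γ p = g ∧ l ≤ p.length

/-- Any two vertices `u`, `v` of `Z` are joined by paths through `R` of length at least `l`, whose
values include a translate of `S`. -/
def Linked (G : SimpleGraph V) (γ : Sym2 V → Γ) (R Z : Set V) (S : Set Γ) (l : ℕ) : Prop :=
  ∀ u ∈ Z, ∀ v ∈ Z, u ≠ v → ∃ c : Γ, ∀ s ∈ S, Route G γ (insert u (insert v R)) u v (c + s) l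

/-- Modulo `H`, the value of a path in `Y` depends only on its ends. -/
def Rigid (G : SimpleGraph V) (γ : Sym2 V → Γ) (H : AddSubgroup Γ) (Y : Set V) : Prop :=
  ∀ u v g g' l l', Route G γ Y u v g l → Route G γ Y u v g' l' → g - g' ∈ H

variable {G : SimpleGraph V} {γ : Sym2 V → Γ} {A : Set Γ} {Y Z R : Set V} {H : AddSubgroup Γ}
  {u v w : V} {g g' : Γ} {l l' : ℕ} {S T : Set Γ}

/-! ### Splitting into classes -/

namespace Part

lemma mono {n m : ℕ} (h : Part G γ A Y n) (hZ : Z ⊆ Y) (hn : n ≤ m) : Part G γ A Z m := by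
  obtain ⟨c, hc, hC⟩ := h
  exact ⟨c, fun y hy => (hc y (hZ hy)).trans_le hn,
    fun x C h1 h2 h3 => hC x C h1 h2 fun y hy => hZ (h3 y hy)⟩

lemma union {a b : ℕ} (hY : Part G γ A Y a) (hZ : Part G γ A Z b) :
    Part G γ A (Y ∪ Z) (a + b) := by
  classical
  obtain ⟨c, hc, hC⟩ := hY
  obtain ⟨c', hc', hC'⟩ := hZ
  refine ⟨fun y => if y ∈ Y then c y else a + c' y, ?_, ?_⟩
  · rintro y (hy | hy)
    · have := hc y hy
      simp only [hy, if_true]; omega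
    · have := hc' y hy
      by_cases h : y ∈ Y
      · have := hc y h
        simp only [h, if_true]; omega
      · simp only [h, if_false]; omega
  · intro x C h1 h2 h3
    by_contra! hcon
    by_cases hx : x ∈ Y
    · have hall : ∀ y ∈ C.support, y ∈ Y ∧ c y = c x := by
        intro y hy
        have := hcon y hy
        have hxa := hc x hx
        by_cases h : y ∈ Y
        · simpa [h, hx] using this
        · simp only [h, hx, if_true, if_false] at this; omega
      obtain ⟨y, hy, hne⟩ := hC x C h1 h2 fun y hy => (hall y hy).1
      exact hne (hall y hy).2
    · have hall : ∀ y ∈ C.support, y ∉ Y ∧ c' y = c' x := by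
        intro y hy
        have hyx := hcon y hy
        by_cases h : y ∈ Y
        · have := hc y h
          simp only [h, hx, if_true, if_false] at hyx; omega
        · refine ⟨h, ?_⟩
          simp only [h, hx, if_false] at hyx; omega
      obtain ⟨y, hy, hne⟩ := hC' x C h1 h2 fun y hy => (h3 y hy).resolve_left (hall y hy).1
      exact hne (hall y hy).2

lemma insert_vertex {n : ℕ} (hY : Part G γ A Y n) (y : V) : Part G γ A (insert y Y) (1 + n) := by
  refine union (Y := {y}) ⟨fun _ => 0, by simp, ?_⟩ hY
  intro x C h1 h2 h3
  exfalso
  cases C with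
  | nil => exact h1.ne_nil rfl
  | cons h p =>
    have ha := h3 _ (Walk.start_mem_support _)
    have hb := h3 _ (List.mem_cons_of_mem _ p.start_mem_support)
    simp only [Set.mem_singleton_iff] at ha hb
    exact h.ne (ha.trans hb.symm)

/-- If `f` refines adjacency in `Y` to the fibres of `idx`, each of which needs `n` classes, then
`Y` needs at most `m * n` classes, with `m` the number of values of `f`. -/
lemma of_fibers {ι : Type*} {m n : ℕ} (f : V → ℕ) (idx : V → ι) (hf : ∀ y ∈ Y, f y < m)
    (hidx : ∀ a ∈ Y, ∀ b ∈ Y, G.Adj a b → f a = f b → idx a = idx b)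
    (hP : ∀ i, Part G γ A {y ∈ Y | idx y = i} n) : Part G γ A Y (m * n) := by
  choose c hc hC using hP
  -- Since `f y < m`, this number encodes the pair of colours; reduction modulo `m` recovers `f`. A
  -- monochromatic cycle then stays in one fibre of `idx`, being connected.
  refine ⟨fun y => f y + m * c (idx y) y, ?_, ?_⟩
  · intro y hy
    have h1 := hf y hy
    have h2 := hc (idx y) y ⟨hy, rfl⟩
    calc f y + m * c (idx y) y < m + m * c (idx y) y := by omega
      _ = m * (c (idx y) y + 1) := by ring
      _ ≤ m * n := Nat.mul_le_mul_left _ h2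
  · intro x C h1 h2 h3
    by_contra! hcon
    have hmod : ∀ y ∈ C.support, f y = f x := by
      intro y hy
      have h := congrArg (· % m) (hcon y hy)
      simpa [Nat.mod_eq_of_lt (hf y (h3 y hy)),
        Nat.mod_eq_of_lt (hf x (h3 x C.start_mem_support))] using h
    have key : ∀ {a b : V} (p : G.Walk a b), (∀ y ∈ p.support, y ∈ C.support) →
        ∀ y ∈ p.support, idx y = idx a := by
      intro a b p
      induction p with
      | nil => simp
      | cons h p ih =>
        intro hs y hy
        have ha := hs _ (Walk.start_mem_support _)
        have hb := hs _ (List.mem_cons_of_mem _ p.start_mem_support)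
        rw [Walk.support_cons, List.mem_cons] at hy
        rcases hy with rfl | hy
        · rfl
        · rw [ih (fun z hz => hs z (List.mem_cons_of_mem _ hz)) y hy]
          exact (hidx _ (h3 _ ha) _ (h3 _ hb) h ((hmod _ ha).trans (hmod _ hb).symm)).symm
    have hi := key C fun _ h => h
    obtain ⟨y, hy, hne⟩ := hC (idx x) x C h1 h2 fun y hy => ⟨h3 y hy, hi y hy⟩
    have h := hcon y hy
    rw [hi y hy, hmod y hy] at h
    have hm : 0 < m := (Nat.zero_le _).trans_lt (hf x (h3 x C.start_mem_support))
    exact hne (Nat.eq_of_mul_eq_mul_left hm (Nat.add_left_cancel h))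

/-- A set whose finite subsets all split into `n` classes splits into `n` classes. -/
lemma of_finite {n : ℕ} (h : ∀ Y : Finset V, Part G γ A Y n) : Part G γ A Set.univ n := by
  classical
  choose c hc hC using h
  -- Each vertex receives its limit colour along an ultrafilter containing all sets of finite
  -- supersets of a given finite set. A cycle has finitely many vertices, so some finite colouring
  -- agrees with the limit on all of it.
  let F : Ultrafilter (Finset V) := Ultrafilter.of Filter.atTop
  have hF : ∀ s : Finset V, ∀ᶠ Y in (F : Filter (Finset V)), s ⊆ Y := fun s =>
    Filter.Eventually.filter_mono (Ultrafilter.of_le _) (Filter.eventually_ge_atTop s)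
  have hlim : ∀ x : V, ∃ i ∈ Set.Iio n, ∀ᶠ Y in (F : Filter (Finset V)), c Y x = i := by
    intro x
    rw [← Ultrafilter.eventually_exists_mem_iff (Set.finite_Iio n)]
    filter_upwards [hF {x}] with Y hY
    exact ⟨c Y x, hc Y x (by simpa using hY), rfl⟩
  choose k hk hkF using hlim
  refine ⟨k, fun y _ => hk y, ?_⟩
  intro x C h1 h2 _
  by_contra! hcon
  have hall : ∀ᶠ Y in (F : Filter (Finset V)), ∀ y ∈ C.support.toFinset, c Y y = k y :=
    (Filter.eventually_all_finset _).2 fun y _ => hkF y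
  obtain ⟨Y, hY, hs⟩ := (hall.and (hF C.support.toFinset)).exists
  obtain ⟨y, hy, hne⟩ := hC Y x C h1 h2 fun y hy => hs (by simpa using hy)
  apply hne
  rw [hY y (by simpa using hy), hY x (by simp), hcon y hy]

/-- A finite set needs at most as many classes as it has elements. -/
lemma ncard (hY : Y.Finite) : Part G γ A Y Y.ncard := by
  induction Y, hY using Set.Finite.induction_on with
  | empty => exact ⟨fun _ => 0, by simp, fun x C _ _ h => (h x C.start_mem_support).elim⟩
  | insert ha hs ih => rw [Set.ncard_insert_of_notMem ha hs, add_comm]; exact ih.insert_vertex _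

end Part

/-- A finite set needing many classes contains two disjoint sets needing many classes. -/
lemma exists_split {a b : ℕ} (hY : Y.Finite) (h : ¬ Part G γ A Y (1 + a + b)) :
    ∃ Y₁ Y₂, Y₁ ⊆ Y ∧ Y₂ ⊆ Y ∧ Disjoint Y₁ Y₂ ∧ ¬ Part G γ A Y₁ a ∧ ¬ Part G γ A Y₂ b := by
  -- A minimal subset not splitting into `a` classes splits into `1 + a`, by deleting one vertex; so
  -- its complement cannot split into `b`.
  obtain ⟨Y₁, hle, hmin⟩ := Set.Finite.exists_le_minimal
    (s := {X | X ⊆ Y ∧ ¬ Part G γ A X a}) (hY.finite_subsets.subset fun X hX => hX.1) (a := Y) ⟨subset_rfl, fun h' => h (h'.mono subset_rfl (by omega))⟩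
  obtain ⟨h1, h2⟩ := hmin.prop
  refine ⟨Y₁, Y \ Y₁, h1, Set.sdiff_subset, Set.disjoint_sdiff_right, h2, fun h3 => h ?_⟩
  obtain ⟨y, hy⟩ : Y₁.Nonempty := by
    rw [Set.nonempty_iff_ne_empty]
    rintro rfl
    exact h2 ⟨fun _ => 0, by simp, fun x C _ _ h => (h x C.start_mem_support).elim⟩
  have h4 : Part G γ A (Y₁ \ {y}) a := by
    by_contra h4
    exact (hmin.le_of_le ⟨Set.sdiff_subset.trans h1, h4⟩ Set.sdiff_subset hy).2 rfl
  have h5 := (h4.insert_vertex y).union h3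
  rwa [Set.insert_sdiff_singleton, Set.insert_eq_of_mem hy, Set.union_sdiff_cancel h1] at h5

/-! ### Gluing paths -/

namespace Route

lemma mono (h : Route G γ Y u v g l) (hY : ∀ x ∈ Y, x ∈ Z) (hl : l' ≤ l) :
    Route G γ Z u v g l' := by
  obtain ⟨p, h1, h2, h3, h4⟩ := h
  exact ⟨p, h1, fun x hx => hY x (h2 x hx), h3, hl.trans h4⟩

lemma symm (h : Route G γ Y u v g l) : Route G γ Y v u g l := by
  obtain ⟨p, h1, h2, h3, h4⟩ := h
  exact ⟨p.reverse, h1.reverse, by simpa using h2, by simpa using h3, by simpa using h4⟩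

lemma mem_left (h : Route G γ Y u v g l) : u ∈ Y := by
  obtain ⟨p, h1, h2, h3, h4⟩ := h
  exact h2 _ p.start_mem_support

lemma mem_right (h : Route G γ Y u v g l) : v ∈ Y := h.symm.mem_left

lemma of_adj (h : G.Adj u v) (hu : u ∈ Y) (hv : v ∈ Y) : Route G γ Y u v (γ s(u, v)) 1 :=
  ⟨.cons h .nil, by simp [h.ne], by simp [hu, hv], by simp, by simp⟩

lemma trans (h : Route G γ Y u v g l) (h' : Route G γ Z v w g' l')
    (hd : ∀ x ∈ Y, x ∈ Z → x = v) : Route G γ (Y ∪ Z) u w (g + g') (l + l') := by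
  obtain ⟨p, h1, h2, h3, h4⟩ := h
  obtain ⟨q, k1, k2, k3, k4⟩ := h'
  refine ⟨p.append q, ?_, ?_, by simp [h3, k3], by simp; omega⟩
  · rw [Walk.isPath_def, Walk.support_append, List.nodup_append]
    have hq := k1.support_nodup
    rw [← Walk.cons_tail_support, List.nodup_cons] at hq
    refine ⟨h1.support_nodup, hq.2, ?_⟩
    rintro a ha b hb rfl
    exact hq.1 (hd a (h2 a ha) (k2 a (List.mem_of_mem_tail hb)) ▸ hb)
  · intro x hx
    rw [Walk.mem_support_append_iff] at hx
    exact hx.imp (h2 x) (k2 x)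

lemma of_le {G' : SimpleGraph V} (hG : G ≤ G') (h : Route G γ Y u v g l) :
    Route G' γ Y u v g l := by
  obtain ⟨p, h1, h2, h3, h4⟩ := h
  exact ⟨p.mapLe hG, (Walk.isPath_mapLe hG).2 h1, by simpa using h2, by simpa using h3,
    by simpa using h4⟩

end Route

/-! ### Breadth first layers and gadgets -/

/-- The edges of `G` inside `Y`, as a spanning subgraph. -/
def within (G : SimpleGraph V) (Y : Set V) : SimpleGraph V where
  Adj a b := G.Adj a b ∧ a ∈ Y ∧ b ∈ Y
  symm := ⟨fun _ _ h => ⟨h.1.symm, h.2.2, h.2.1⟩⟩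
  loopless := ⟨fun _ h => h.1.ne rfl⟩

lemma within_le : within G Y ≤ G := fun _ _ h => h.1

lemma support_within (hu : u ∈ Y) (p : (within G Y).Walk u v) : ∀ x ∈ p.support, x ∈ Y := by
  induction p with
  | nil => simpa using hu
  | cons h p ih =>
    intro x hx
    rw [Walk.support_cons, List.mem_cons] at hx
    rcases hx with rfl | hx
    · exact hu
    · exact ih h.2.2 x hx

/-- Some layer of a breadth first search needs at least half as many classes, and any two of its
vertices are joined through the other vertices. -/
lemma exists_layer {n : ℕ} (h : ¬ Part G γ A Y (2 * n)) :
    ∃ Z ⊆ Y, ¬ Part G γ A Z n ∧ Linked G γ (Y \ Z) Z {0} 1 := by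
  classical
  let K := within G Y
  let root : K.ConnectedComponent → V := fun C => C.exists_rep.choose
  have hroot : ∀ C, K.connectedComponentMk (root C) = C := fun C => C.exists_rep.choose_spec
  let idx : V → K.ConnectedComponent × ℕ := fun x =>
    (K.connectedComponentMk x, K.dist (root (K.connectedComponentMk x)) x)
  obtain ⟨i, hi⟩ : ∃ i, ¬ Part G γ A {y ∈ Y | idx y = i} n := by
    by_contra! hcon
    -- Distances of adjacent vertices from the root differ by at most one, so equal parity forces
    -- equal layers.
    refine h (Part.of_fibers (fun x => (idx x).2 % 2) idx
      (fun y _ => Nat.mod_lt _ two_pos) ?_ hcon)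
    intro a ha b hb hab hpar
    have hK : K.Adj a b := ⟨hab, ha, hb⟩
    have hC : K.connectedComponentMk a = K.connectedComponentMk b :=
      ConnectedComponent.sound hK.reachable
    have hd := hK.diff_dist_adj (u := root (K.connectedComponentMk b))
    simp only [idx, hC] at hpar ⊢
    rw [Prod.mk.injEq]
    exact ⟨rfl, by omega⟩
  obtain ⟨C, i⟩ := i
  refine ⟨{y ∈ Y | idx y = (C, i)}, fun y hy => hy.1, hi, ?_⟩
  have geod : ∀ x ∈ Y, idx x = (C, i) →
      ∃ p : K.Walk (root C) x, ∀ y ∈ p.support, y ≠ x → K.dist (root C) y < i := by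
    intro x _ hx
    simp only [idx, Prod.mk.injEq] at hx
    obtain ⟨rfl, hx⟩ := hx
    have hr : K.Reachable (root (K.connectedComponentMk x)) x :=
      ConnectedComponent.exact (hroot _)
    obtain ⟨p, hp⟩ := hr.exists_walk_length_eq_dist
    refine ⟨p, fun y hy hne => ?_⟩
    have h1 := dist_le (p.takeUntil y hy)
    have h2 := p.length_takeUntil_lt_length hy hne
    omega
  rintro u ⟨huY, hu⟩ v ⟨hvY, hv⟩ huv
  obtain ⟨p, hp⟩ := geod u huY hu
  obtain ⟨q, hq⟩ := geod v hvY hv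
  -- Two geodesics to the root, joined there, meet the layer only in `u` and `v`.
  let W := (p.reverse.append q).bypass
  have hW : ∀ x ∈ W.support, x = u ∨ x = v ∨ K.dist (root C) x < i := by
    intro x hx
    have hx := Walk.support_bypass_subset_support _ hx
    rw [Walk.mem_support_append_iff, Walk.support_reverse, List.mem_reverse] at hx
    by_contra! hcon
    rcases hx with hx | hx
    · exact absurd (hp x hx hcon.1) (by omega)
    · exact absurd (hq x hx hcon.2.1) (by omega)
  refine ⟨wt γ W, fun s hs => ⟨W.mapLe within_le, ?_, ?_, ?_, ?_⟩⟩
  · exact (Walk.isPath_mapLe _).2 (Walk.bypass_isPath _)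
  · intro x hx
    rw [Walk.support_mapLe_eq_support] at hx
    rcases hW x hx with rfl | rfl | hlt
    · simp
    · simp
    · refine Or.inr (Or.inr ⟨support_within huY W x hx, fun hx' => ?_⟩)
      have h2 := hx'.2
      simp only [idx, Prod.mk.injEq] at h2
      rw [h2.1] at h2
      omega
  · rw [Set.mem_singleton_iff.1 hs]; simp
  · rw [Walk.length_mapLe, Nat.one_le_iff_ne_zero]
    exact fun h0 => huv (Walk.eq_of_length_eq_zero h0)

/-- Insert a gadget, two vertices `a`, `b` joined by paths with values `T`, between two links. -/
lemma Linked.insert_gadget {R' Z' Z₁ Z₂ : Set V} {m : ℕ} {a b : V} (h : Linked G γ R Z S l)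
    (h' : Linked G γ R' Z' {0} 1) (hR : Disjoint R Z) (hR' : R' ⊆ Z \ Z') (hZ' : Z' ⊆ Z)
    (h1 : Z₁ ⊆ Z') (h2 : Z₂ ⊆ Z') (hd : Disjoint Z₁ Z₂) (hab : a ≠ b)
    (hT : ∀ t ∈ T, Route G γ Z₁ a b t m) (hTn : T.Nonempty) :
    Linked G γ (R ∪ R' ∪ Z₁) Z₂ (S + T) (l + m + 1) := by
  intro u hu v hv huv
  obtain ⟨t0, ht0⟩ := hTn
  have ha : a ∈ Z₁ := (hT t0 ht0).mem_left
  have hb : b ∈ Z₁ := (hT t0 ht0).mem_right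
  rw [Set.disjoint_left] at hR hd
  have hua : u ≠ a := fun e => hd ha (e ▸ hu)
  have hbv : b ≠ v := fun e => hd hb (e ▸ hv)
  have hav : a ≠ v := fun e => hd ha (e ▸ hv)
  -- The new link goes from `u` to `a` through `R`, from `a` to `b` inside `Z₁`, and from `b` to `v`
  -- through `R'`; the last piece has fixed value.
  obtain ⟨c, hc⟩ := h u (hZ' (h2 hu)) a (hZ' (h1 ha)) hua
  obtain ⟨c', hc'⟩ := h' b (h1 hb) v (h2 hv) hbv
  refine ⟨c + c', ?_⟩
  rintro _ ⟨s, hs, t, ht, rfl⟩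
  have r1 := (hc s hs).trans (hT t ht) (by
    rintro x (rfl | rfl | hx) hx1
    · exact (hd hx1 hu).elim
    · rfl
    · exact (hR hx (hZ' (h1 hx1))).elim)
  have r2 := r1.trans (hc' 0 rfl) (by
    have hnot : ∀ x ∈ R', x ∉ Z' := fun x hx => (hR' hx).2
    have hin : ∀ x ∈ R', x ∈ Z := fun x hx => (hR' hx).1
    rintro x ((rfl | rfl | hx) | hx) (rfl | rfl | hx')
    · rfl
    · exact (huv rfl).elim
    · exact (hnot _ hx' (h2 hu)).elim
    · rfl
    · exact (hav rfl).elim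
    · exact (hnot _ hx' (h1 ha)).elim
    · rfl
    · exact (hR hx (hZ' (h2 hv))).elim
    · exact (hR hx (hin _ hx')).elim
    · rfl
    · exact (hd hx hv).elim
    · exact (hnot _ hx' (h1 hx)).elim)
  have e : c + s + t + (c' + 0) = c + c' + (s + t) := by abel
  rw [e] at r2
  refine r2.mono ?_ le_rfl
  rintro x (((rfl | rfl | hx) | hx) | (rfl | rfl | hx)) <;> simp [*]

/-! ### Cycles in rigid sets -/

lemma exists_eq_append_cons {x y : V} (p : G.Walk x y) {e : Sym2 V} (he : e ∈ p.edges) :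
    ∃ (a b : V) (h : G.Adj a b) (p₁ : G.Walk x a) (p₂ : G.Walk b y),
      e = s(a, b) ∧ p = p₁.append (.cons h p₂) := by
  induction p with
  | nil => simp at he
  | cons h p ih =>
    rw [Walk.edges_cons, List.mem_cons] at he
    rcases he with rfl | he
    · exact ⟨_, _, h, .nil, p, rfl, rfl⟩
    · obtain ⟨a, b, h', p₁, p₂, rfl, rfl⟩ := ih he
      exact ⟨a, b, h', .cons h p₁, p₂, rfl, rfl⟩

/-- In a rigid set, cycles have value `0` and their edges have order at most two, modulo `H`. -/
lemma Rigid.of_mem_cycle (hr : Rigid G γ H Y) {x : V} {C : G.Walk x x} (hC : C.IsCycle)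
    (hY : ∀ y ∈ C.support, y ∈ Y) {e : Sym2 V} (he : e ∈ C.edges) :
    γ e + γ e ∈ H ∧ wt γ C ∈ H := by
  obtain ⟨a, b, h, p₁, p₂, rfl, rfl⟩ := exists_eq_append_cons C he
  have hlen := hC.three_le_length
  have hw : wt γ (p₁.append (.cons h p₂)) = γ s(a, b) + wt γ (p₂.append p₁) := by
    simp only [wt_append, wt_cons]; abel
  have hp : (p₂.append p₁).IsPath := by
    have := hC.support_nodup
    rw [Walk.isPath_def, Walk.support_append]
    rw [Walk.support_append, Walk.support_cons, List.tail_cons, ← Walk.cons_tail_support p₁,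
      List.cons_append, List.tail_cons] at this
    exact List.nodup_append_comm.1 this
  have hs : ∀ y ∈ (p₂.append p₁).support, y ∈ Y := by
    intro y hy
    apply hY
    rw [Walk.mem_support_append_iff] at hy ⊢
    rcases hy with hy | hy
    · exact Or.inr (List.mem_cons_of_mem _ hy)
    · exact Or.inl hy
  have hl : 2 ≤ (p₂.append p₁).length := by
    simp only [Walk.length_append, Walk.length_cons] at hlen ⊢; omega
  rw [hw]
  generalize p₂.append p₁ = p at hp hs hl
  cases p with
  | nil => simp at hl
  | @cons _ c _ h' q =>
    rw [Walk.cons_isPath_iff] at hp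
    have hqY : ∀ y ∈ q.support, y ∈ Y := fun y hy => hs y (List.mem_cons_of_mem _ hy)
    have hbY : b ∈ Y := hs b (Walk.start_mem_support _)
    have hcY : c ∈ Y := hqY c q.start_mem_support
    have haY : a ∈ Y := hqY a q.end_mem_support
    have hca : c ≠ a := by
      rintro rfl
      have := Walk.length_eq_zero_iff.2 (Walk.isPath_iff_nil.1 hp.1)
      simp [this] at hl
    have hbq := hp.2
    have rq : Route G γ (Y \ {b}) c a (wt γ q) 0 :=
      ⟨q, hp.1, fun y hy => ⟨hqY y hy, fun e => hbq (e ▸ hy)⟩, rfl, Nat.zero_le _⟩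
    have rqY : Route G γ Y c a (wt γ q) 0 := rq.mono (fun x hx => hx.1) le_rfl
    have rbc : Route G γ {b, c} b c (γ s(b, c)) 1 := Route.of_adj h' (by simp) (by simp)
    have rab : Route G γ {a, b} a b (γ s(a, b)) 1 := Route.of_adj h (by simp) (by simp)
    have hbne : b ≠ c := h'.ne
    have hane : a ≠ b := h.ne
    have sub : ∀ s : Set V, s ⊆ Y → ∀ x ∈ s ∪ Y \ {b}, x ∈ Y := by
      rintro s hs x (hx | hx)
      exacts [hs hx, hx.1]
    -- Cut the cycle into the edges `ab`, `bc` and the path `q`, with values `α`, `β`, `κ`.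
    -- Comparing the two ways round between each two of `a`, `b`, `c` gives `α ≡ β + κ`, `β ≡ κ + α`
    -- and `α + β ≡ κ`, hence `α + β + κ ≡ 0` and `2α ≡ 0`.
    have e1 := hr _ _ _ _ _ _ (rab.mono (Z := Y) (by simp [haY, hbY]) le_rfl).symm
      ((rbc.trans rq (by
        rintro x (rfl | rfl) hx
        · exact (hx.2 rfl).elim
        · rfl)).mono (sub _ (by simp [Set.insert_subset_iff, hbY, hcY])) le_rfl)
    have e2 := hr _ _ _ _ _ _ (rbc.mono (Z := Y) (by simp [hcY, hbY]) le_rfl).symm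
      ((rq.trans rab (by
        rintro x hx (rfl | rfl)
        · rfl
        · exact (hx.2 rfl).elim)).mono (by
          rintro x (hx | rfl | rfl)
          exacts [hx.1, haY, hbY]) le_rfl)
    have e3 := hr _ _ _ _ _ _ ((rab.trans rbc (by
        rintro x (hx | hx) (hx' | hx')
        exacts [hx', (hca (hx'.symm.trans hx)).elim, hx, hx])).mono (Z := Y) (by
          rintro x ((rfl | rfl) | rfl | rfl) <;> assumption) le_rfl) rqY.symm
    have hv : γ s(a, b) + wt γ (Walk.cons h' q) ∈ H := by
      have := H.sub_mem (H.add_mem e1 e2) e3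
      rw [wt_cons]
      convert H.neg_mem this using 1
      abel
    refine ⟨?_, hv⟩
    convert H.add_mem e1 hv using 1
    rw [wt_cons]
    abel

/-! ### Linked sets and potentials modulo a subgroup -/

/-- The conclusion of one linking step: a set that still needs many classes, any two vertices of
which are joined through the rest of `Y` by a long path of value in `A`. -/
def HasLinkedSet (G : SimpleGraph V) (γ : Sym2 V → Γ) (A : Set Γ) (d k : ℕ) (Y : Set V) : Prop :=
  ∃ X ⊆ Y, ¬ Part G γ A X k ∧ ∀ u ∈ X, ∀ v ∈ X, u ≠ v →
    ∃ g ∈ A, Route G γ (insert u (insert v (Y \ X))) u v g d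

lemma HasLinkedSet.mono {d k : ℕ} (h : HasLinkedSet G γ A d k Z) (hZ : Z ⊆ Y) :
    HasLinkedSet G γ A d k Y := by
  obtain ⟨X, h1, h2, h3⟩ := h
  refine ⟨X, h1.trans hZ, h2, fun u hu v hv huv => ?_⟩
  obtain ⟨g, hg, hr⟩ := h3 u hu v hv huv
  refine ⟨g, hg, hr.mono ?_ le_rfl⟩
  rintro x (rfl | rfl | hx)
  · simp
  · simp
  · exact Or.inr (Or.inr ⟨hZ hx.1, hx.2⟩)

/-- Finite sets that are rigid modulo `H` and need more than `n` classes have a linked subset. -/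
def Bound (γ : Sym2 V → Γ) (A : Set Γ) (d k : ℕ) (H : AddSubgroup Γ) (n : ℕ) : Prop :=
  ∀ (G : SimpleGraph V) (Y : Set V), Y.Finite → Rigid G γ H Y → ¬ Part G γ A Y n →
    HasLinkedSet G γ A d k Y

lemma Rigid.mono_graph {K : SimpleGraph V} (hr : Rigid G γ H Y) (h : K ≤ G) : Rigid K γ H Y :=
  fun u v g g' l l' h1 h2 => hr u v g g' l l' (h1.of_le h) (h2.of_le h)

lemma Rigid.mono (hr : Rigid G γ H Y) (h : Z ⊆ Y) : Rigid G γ H Z :=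
  fun u v g g' l l' h1 h2 => hr u v g g' l l' (h1.mono h le_rfl) (h2.mono h le_rfl)

/-- A detour cut out by `bypass` is an edge followed by a path back to its start. By rigidity both
have the same value modulo `H`, so the detour contributes twice an edge label, which is in `H`. -/
lemma Rigid.sub_bypass_mem [DecidableEq V] (hr : Rigid G γ H Y)
    (h2 : ∀ a b, G.Adj a b → γ s(a, b) + γ s(a, b) ∈ H) (p : G.Walk u v)
    (hp : ∀ x ∈ p.support, x ∈ Y) : wt γ p - wt γ p.bypass ∈ H := by
  induction p with
  | nil => simp [Walk.bypass, H.zero_mem]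
  | @cons a b c h p ih =>
    have hpY : ∀ x ∈ p.support, x ∈ Y := fun x hx => hp x (List.mem_cons_of_mem _ hx)
    have ih := ih hpY
    have hq := p.bypass_isPath
    have hqY : ∀ x ∈ p.bypass.support, x ∈ Y := fun x hx =>
      hpY x (Walk.support_bypass_subset_support _ hx)
    rw [Walk.bypass]
    generalize p.bypass = q at *
    split_ifs with hs
    · have e := congrArg (wt γ) (q.take_spec hs)
      rw [wt_append] at e
      have r1 : Route G γ Y a b (γ s(a, b)) 1 :=
        Route.of_adj h (hp a (Walk.start_mem_support _)) (hpY b p.start_mem_support)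
      have r2 : Route G γ Y b a (wt γ (q.takeUntil a hs)) 0 :=
        ⟨_, hq.takeUntil hs, fun x hx => hqY x (q.support_takeUntil_subset_support hs hx),
          rfl, Nat.zero_le _⟩
      have := H.add_mem (H.sub_mem (h2 a b h) (hr _ _ _ _ _ _ r1 r2.symm)) ih
      convert this using 1
      rw [← e, wt_cons]
      abel
    · simpa using ih

lemma Rigid.sub_mem_of_walks (hr : Rigid G γ H Y)
    (h2 : ∀ a b, G.Adj a b → γ s(a, b) + γ s(a, b) ∈ H) (p q : G.Walk u v)
    (hp : ∀ x ∈ p.support, x ∈ Y) (hq : ∀ x ∈ q.support, x ∈ Y) : wt γ p - wt γ q ∈ H := by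
  classical
  have e1 := hr.sub_bypass_mem h2 p hp
  have e2 := hr.sub_bypass_mem h2 q hq
  have e3 := hr u v _ _ 0 0
    ⟨_, p.bypass_isPath, fun x hx => hp x (Walk.support_bypass_subset_support _ hx), rfl,
      Nat.zero_le _⟩
    ⟨_, q.bypass_isPath, fun x hx => hq x (Walk.support_bypass_subset_support _ hx), rfl,
      Nat.zero_le _⟩
  convert H.sub_mem (H.add_mem e1 e3) e2 using 1
  abel

lemma wt_add_self_mem (h2 : ∀ a b, G.Adj a b → γ s(a, b) + γ s(a, b) ∈ H) (p : G.Walk u v) :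
    wt γ p + wt γ p ∈ H := by
  induction p with
  | nil => simp [H.zero_mem]
  | cons h p ih =>
    rw [wt_cons]
    convert H.add_mem (h2 _ _ h) ih using 1
    abel

/-- The potential of a vertex is the value of a fixed walk to the root of its component. Signs are
irrelevant modulo `H` because doubled values lie in `H`. -/
lemma Rigid.exists_potential (hr : Rigid G γ H Y)
    (h2 : ∀ a b, G.Adj a b → γ s(a, b) + γ s(a, b) ∈ H) :
    ∃ p : V → Γ, (∀ v, p v + p v ∈ H) ∧
      ∀ u v g l, Route G γ Y u v g l → g - (p u + p v) ∈ H := by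
  classical
  let K := within G Y
  let root : K.ConnectedComponent → V := fun C => C.exists_rep.choose
  have hroot : ∀ C, K.connectedComponentMk (root C) = C := fun C => C.exists_rep.choose_spec
  have hreach : ∀ x, K.Reachable x (root (K.connectedComponentMk x)) := fun x =>
    ConnectedComponent.exact (hroot _).symm
  let W : ∀ x, K.Walk x (root (K.connectedComponentMk x)) := fun x => (hreach x).some
  have hd : ∀ v, wt γ (W v) + wt γ (W v) ∈ H := fun v =>
    wt_add_self_mem (fun a b h => h2 a b (within_le h)) _
  refine ⟨fun x => wt γ (W x), hd, ?_⟩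
  rintro u v g l ⟨P, -, hPY, rfl, -⟩
  have hPK : ∀ e ∈ P.edges, e ∈ K.edgeSet := by
    intro e he
    induction e using Sym2.ind with
    | _ a b =>
      exact ⟨P.adj_of_mem_edges he, hPY a (P.fst_mem_support_of_mem_edges he),
        hPY b (P.snd_mem_support_of_mem_edges he)⟩
  have hC : K.connectedComponentMk u = K.connectedComponentMk v :=
    ConnectedComponent.sound ⟨P.transfer K hPK⟩
  have hu : u ∈ Y := hPY u P.start_mem_support
  have hv : v ∈ Y := hPY v P.end_mem_support
  have key : ∀ (r : V) (q : K.Walk u r) (q' : K.Walk v r),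
      wt γ (P.append (q'.mapLe within_le)) - wt γ (q.mapLe within_le) ∈ H := by
    intro r q q'
    refine hr.sub_mem_of_walks h2 _ _ (fun x hx => ?_) (fun x hx => ?_)
    · rw [Walk.mem_support_append_iff, Walk.support_mapLe_eq_support] at hx
      exact hx.elim (hPY x) (support_within hv _ x)
    · rw [Walk.support_mapLe_eq_support] at hx
      exact support_within hu _ x hx
  have e := key _ (W u) ((W v).copy rfl (by rw [hC]))
  have hcopy : ∀ (r s : V) (q : K.Walk v r) (h : r = s), wt γ (q.copy rfl h) = wt γ q := by
    rintro r _ q rfl; rfl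
  rw [wt_append, wt_mapLe, wt_mapLe, hcopy] at e
  convert H.sub_mem e (hd v) using 1
  abel

/-- Greedy colouring for a symmetric relation with at most `n` neighbours per element. -/
lemma exists_coloring {Q : Type*} (r : Q → Q → Prop) (hr : ∀ x y, r x y → r y x) (n : ℕ)
    (hn : ∀ x, {y | r x y}.encard ≤ n) {T : Set Q} (hT : T.Finite) :
    ∃ c : Q → ℕ, (∀ x, c x < n + 1) ∧ ∀ x ∈ T, ∀ y ∈ T, x ≠ y → c x = c y → ¬ r x y := by
  classical
  induction T, hT using Set.Finite.induction_on with
  | empty => exact ⟨fun _ => 0, by simp, by simp⟩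
  | @insert x T hx hT ih =>
    obtain ⟨c, hc, hcT⟩ := ih
    obtain ⟨i, hi, hi'⟩ : ∃ i ∈ Set.Iio (n + 1), i ∉ c '' {y | r x y} := by
      by_contra! hcon
      have h1 : (Set.Iio (n + 1)).encard ≤ n :=
        (Set.encard_le_encard hcon).trans ((Set.encard_image_le _ _).trans (hn x))
      rw [Set.encard_eq_coe_toFinset_card, Nat.cast_le] at h1
      simp at h1
    refine ⟨Function.update c x i, fun y => ?_, ?_⟩
    · rcases eq_or_ne y x with rfl | h
      · simpa using hi
      · simpa [h] using hc y
    · have hne : ∀ y ∈ T, y ≠ x := fun y hy e => hx (e ▸ hy)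
      rintro y (rfl | hy) z (rfl | hz) hyz he hryz
      · exact hyz rfl
      · rw [Function.update_self, Function.update_of_ne (hne z hz)] at he
        exact hi' ⟨z, hryz, he.symm⟩
      · rw [Function.update_self, Function.update_of_ne (hne y hy)] at he
        exact hi' ⟨y, hr _ _ hryz, he⟩
      · rw [Function.update_of_ne (hne z hz), Function.update_of_ne (hne y hy)] at he
        exact hcT y hy z hz hyz he hryz

/-- A rigid set contains a part, needing many classes, all of whose paths have values in `A`
modulo `H`. -/
lemma Rigid.exists_subset_meeting {ω n : ℕ} (hA : Aᶜ.encard ≤ ω) (hY : Y.Finite)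
    (hr : Rigid G γ H Y) (h2 : ∀ a b, G.Adj a b → γ s(a, b) + γ s(a, b) ∈ H)
    (h : ¬ Part G γ A Y ((ω + 1) * (n + 1))) :
    ∃ Y' ⊆ Y, ¬ Part G γ A Y' n ∧
      ∀ u v g l, Route G γ Y' u v g l → ∃ a ∈ A, a - g ∈ H := by
  obtain ⟨p, hp2, hp⟩ := hr.exists_potential h2
  -- Cycles have value in `H`, so if `A` missed `H` a single class would do; the factor `n + 1`
  -- ensures that one class is allowed even for `n = 0`.
  obtain ⟨a₀, ha₀, ha₀H⟩ : ∃ a ∈ A, a ∈ H := by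
    by_contra! hcon
    refine h (Part.mono (n := 1) ⟨fun _ => 0, by simp, fun x C hC hCA hCY => ?_⟩ subset_rfl
      (Nat.mul_pos (by omega) (by omega)))
    exfalso
    cases C with
    | nil => exact hC.ne_nil rfl
    | cons e q => exact hcon _ hCA (hr.of_mem_cycle hC hCY (List.mem_cons_self ..)).2
  let π : Γ → Γ ⧸ H := QuotientAddGroup.mk
  obtain ⟨c, hc, hcT⟩ := exists_coloring (fun x y : Γ ⧸ H => x + y ∉ π '' A)
    (fun x y h => by rwa [add_comm]) ω (fun x => by
      -- A coset missing `A` contains an element of the complement of `A`, so each `x` has at most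
      -- `ω` conflicts.
      have h1 : (x + ·) '' {y | x + y ∉ π '' A} ⊆ π '' Aᶜ := by
        rintro _ ⟨y, hy, rfl⟩
        obtain ⟨b, hb⟩ := QuotientAddGroup.mk_surjective (x + y)
        exact ⟨b, fun hbA => hy ⟨b, hbA, hb⟩, hb⟩
      rw [← (add_right_injective x).encard_image]
      exact (Set.encard_le_encard h1).trans ((Set.encard_image_le _ _).trans hA))
    (hY.image (fun v => π (p v)))
  obtain ⟨i, hi⟩ : ∃ i, ¬ Part G γ A {y ∈ Y | c (π (p y)) = i} n := by
    by_contra! hcon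
    exact h ((Part.of_fibers (fun y => c (π (p y))) _ (fun y _ => hc _)
      (fun _ _ _ _ _ h => h) hcon).mono subset_rfl (Nat.mul_le_mul_left _ (Nat.le_succ n)))
  refine ⟨_, fun y hy => hy.1, hi, fun u v g l hR => ?_⟩
  obtain ⟨huY, hu⟩ := hR.mem_left
  obtain ⟨hvY, hv⟩ := hR.mem_right
  have hg := hp u v g l (hR.mono (fun x hx => hx.1) le_rfl)
  have hmem : π (p u + p v) ∈ π '' A := by
    -- The colouring says nothing about equal potentials, but then their sum is `0` modulo `H`, a
    -- coset that meets `A` in `a₀`.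
    by_cases he : π (p u) = π (p v)
    · refine ⟨a₀, ha₀, ?_⟩
      have e1 : π (p u + p v) = 0 := by
        change π (p u) + π (p v) = 0
        rw [he]
        exact (QuotientAddGroup.eq_zero_iff _).2 (hp2 v)
      rw [e1]
      exact (QuotientAddGroup.eq_zero_iff _).2 ha₀H
    · exact not_not.1 (hcT _ ⟨u, huY, rfl⟩ _ ⟨v, hvY, rfl⟩ he (hu.trans hv.symm))
  obtain ⟨a, ha, hae⟩ := hmem
  refine ⟨a, ha, ?_⟩
  have := H.sub_mem (H.neg_mem (QuotientAddGroup.eq.1 hae)) hg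
  convert this using 1
  abel

/-! ### Long links and growing value sets -/

/-- The number of classes that forces links of length at least `e` for a set needing more than `n`
classes. -/
def longBound : ℕ → ℕ → ℕ
  | 0, n => 2 * n
  | e + 1, n => longBound e (2 * (1 + 1 + n))

/-- The number of classes that forces `j` further gadgets. -/
def growBound (m k : ℕ) : ℕ → ℕ
  | 0 => k
  | j + 1 => k + 2 * (1 + m + growBound m k j)

lemma exists_adj_of_not_part_one (h : ¬ Part G γ A Y 1) : ∃ a ∈ Y, ∃ b ∈ Y, G.Adj a b := by
  by_contra! hcon
  refine h ⟨fun _ => 0, by simp, fun x C hC _ hCY => ?_⟩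
  cases C with
  | nil => exact (hC.ne_nil rfl).elim
  | cons e q => exact (hcon _ (hCY _ (Walk.start_mem_support _)) _
      (hCY _ (List.mem_cons_of_mem _ q.start_mem_support)) e).elim

lemma Linked.translate (h : Linked G γ R Z {g} l) : Linked G γ R Z {0} l := by
  intro u hu v hv huv
  obtain ⟨c, hc⟩ := h u hu v hv huv
  exact ⟨c + g, fun s hs => by rw [Set.mem_singleton_iff.1 hs, add_zero]; exact hc g rfl⟩

lemma Linked.mono_length (h : Linked G γ R Z S l) (hl : l' ≤ l) : Linked G γ R Z S l' := by
  intro u hu v hv huv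
  obtain ⟨c, hc⟩ := h u hu v hv huv
  exact ⟨c, fun s hs => (hc s hs).mono (fun _ h => h) hl⟩

/-- Every round inserts a single edge as a gadget, which makes the links longer. -/
lemma exists_long_linked (hY : Y.Finite) (e n : ℕ) (h : ¬ Part G γ A Y (longBound e n)) :
    ∃ R Z, R ⊆ Y ∧ Z ⊆ Y ∧ Disjoint R Z ∧ ¬ Part G γ A Z n ∧ Linked G γ R Z {0} e := by
  induction e generalizing n with
  | zero =>
    obtain ⟨Z, hZ, hn, hL⟩ := exists_layer h
    exact ⟨Y \ Z, Z, Set.sdiff_subset, hZ, Set.disjoint_sdiff_left, hn, hL.mono_length (by omega)⟩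
  | succ e ih =>
    obtain ⟨R, Z, hR, hZ, hd, hn, hL⟩ := ih _ h
    obtain ⟨Z', hZ', hn', hL'⟩ := exists_layer hn
    obtain ⟨Z₁, Z₂, h1, h2, hd', hn1, hn2⟩ := exists_split ((hY.subset hZ).subset hZ') hn'
    obtain ⟨a, ha, b, hb, hab⟩ := exists_adj_of_not_part_one hn1
    have := hL.insert_gadget hL' hd subset_rfl hZ' h1 h2 hd' hab.ne (T := {γ s(a, b)})
      (fun t ht => by rw [Set.mem_singleton_iff.1 ht]; exact Route.of_adj hab ha hb) (by simp)
    refine ⟨R ∪ Z \ Z' ∪ Z₁, Z₂, ?_, h2.trans (hZ'.trans hZ), ?_, hn2, ?_⟩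
    · exact Set.union_subset (Set.union_subset hR (Set.sdiff_subset.trans hZ))
        (h1.trans (hZ'.trans hZ))
    · rw [Set.disjoint_union_left, Set.disjoint_union_left]
      exact ⟨⟨hd.mono_right (h2.trans hZ'), Set.disjoint_sdiff_left.mono_right h2⟩, hd'⟩
    · rw [Set.singleton_add_singleton] at this
      exact (this.mono_length (by omega)).translate

lemma ncard_stabilizer_le (hS : S.Finite) (hne : S.Nonempty) :
    (AddAction.stabilizer Γ S : Set Γ).Finite ∧
      (AddAction.stabilizer Γ S : Set Γ).ncard ≤ S.ncard := by
  obtain ⟨s, hs⟩ := hne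
  have hmaps : Set.MapsTo (· + s) (AddAction.stabilizer Γ S : Set Γ) S := by
    intro g hg
    have hg : g +ᵥ S = S := hg
    rw [← hg]
    exact ⟨s, hs, rfl⟩
  exact ⟨Set.Finite.of_injOn hmaps (add_left_injective s).injOn hS,
    Set.ncard_le_ncard_of_injOn _ hmaps (add_left_injective s).injOn hS⟩

/-- Without growth the translates of `S` by `g` and by `g'` both fill `S + {g, g'}`, so `g - g'`
stabilises `S`. -/
lemma ncard_lt_ncard_add_pair (hS : S.Finite) (h : g - g' ∉ AddAction.stabilizer Γ S) :
    S.ncard < (S + {g, g'}).ncard := by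
  by_contra! hle
  have hfin : (S + {g, g'}).Finite := hS.add (by simp)
  have key : ∀ x ∈ ({g, g'} : Set Γ), x +ᵥ S = S + {g, g'} := by
    intro x hx
    refine Set.eq_of_subset_of_ncard_le ?_ ?_ hfin
    · rintro _ ⟨s, hs, rfl⟩
      exact ⟨s, hs, x, hx, add_comm _ _⟩
    · rwa [Set.ncard_vadd_set]
  apply h
  rw [AddAction.mem_stabilizer_iff, sub_eq_neg_add, add_vadd, key g (by simp),
    ← key g' (by simp), neg_vadd_vadd]

/-- Adding gadgets enlarges the set of values of the linking paths until it meets every relevant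
translate of `A`, unless a part that is rigid modulo a smaller subgroup shows up. -/
lemma HasLinkedSet.of_linked {ω d k m : ℕ} (hA : Aᶜ.encard ≤ ω) (hY : Y.Finite)
    (hr : Rigid G γ H Y) (hm : ∀ u v g l, Route G γ Y u v g l → ∃ a ∈ A, a - g ∈ H)
    (hB : ∀ H' < H, (H' : Set Γ).Finite → (H' : Set Γ).ncard ≤ ω → Bound (V := V) γ A d k H' m)
    (j : ℕ) (hR : R ⊆ Y) (hZ : Z ⊆ Y) (hd : Disjoint R Z) (hS : S.Finite) (hSn : S.Nonempty)
    (hL : Linked G γ R Z S d) (hj : ω < S.ncard + j) (hP : ¬ Part G γ A Z (growBound m k j)) :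
    HasLinkedSet G γ A d k Y := by
  have hRZ : R ⊆ Y \ Z := fun x hx => ⟨hR hx, Set.disjoint_left.1 hd hx⟩
  have hsub : ∀ u v : V, ∀ x ∈ insert u (insert v R), x ∈ insert u (insert v (Y \ Z)) :=
    fun u v => Set.insert_subset_insert (Set.insert_subset_insert hRZ)
  induction j generalizing R Z S with
  | zero =>
    refine ⟨Z, hZ, hP, fun u hu v hv huv => ?_⟩
    obtain ⟨c, hc⟩ := hL u hu v hv huv
    by_contra! hcon
    have h1 : c +ᵥ S ⊆ Aᶜ := by
      rintro _ ⟨s, hs, rfl⟩ hA'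
      exact hcon _ hA' ((hc s hs).mono (hsub u v) le_rfl)
    have h2 := (Set.encard_le_encard h1).trans hA
    rw [← (hS.vadd_set (a := c)).cast_ncard_eq, Set.ncard_vadd_set, Nat.cast_le] at h2
    omega
  | succ j ih =>
    have hPk : ¬ Part G γ A Z k := fun h => hP (h.mono subset_rfl (by simp [growBound]))
    -- Here `c + S` is a union of cosets of `H`, and one link value is congruent to an element of
    -- `A`, which is then itself a link value.
    by_cases hH : H ≤ AddAction.stabilizer Γ S
    · refine ⟨Z, hZ, hPk, fun u hu v hv huv => ?_⟩
      obtain ⟨c, hc⟩ := hL u hu v hv huv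
      obtain ⟨s, hs⟩ := hSn
      obtain ⟨a, ha, haH⟩ := hm u v _ _ ((hc s hs).mono (Z := Y) (by
        rintro x (rfl | rfl | hx)
        exacts [hZ hu, hZ hv, hR hx]) le_rfl)
      have hst : (a - (c + s)) +ᵥ S = S := hH haH
      have hmem : (a - (c + s)) + s ∈ S := by
        rw [← hst]; exact ⟨s, hs, rfl⟩
      refine ⟨a, ha, ?_⟩
      have := (hc _ hmem).mono (hsub u v) le_rfl
      convert this using 1
      abel
    -- Once `S` is this large no more gadgets are needed; otherwise the stabiliser of `S` has order
    -- at most `ω`, as `hB` requires.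
    · by_cases hω : ω < S.ncard
      · refine ih (S := S) hR hZ hd hS hSn hL (by omega) (fun h => hP (h.mono subset_rfl ?_))
          hRZ hsub
        simp only [growBound]; omega
      obtain ⟨Z', hZ', hn', hL'⟩ := exists_layer (n := 1 + m + growBound m k j)
        (fun h => hP (h.mono (Y := Z) subset_rfl (by simp [growBound])))
      obtain ⟨Z₁, Z₂, h1, h2, hd', hn1, hn2⟩ := exists_split ((hY.subset hZ).subset hZ') hn'
      have h1Y : Z₁ ⊆ Y := h1.trans (hZ'.trans hZ)
      obtain ⟨hst, hst'⟩ := ncard_stabilizer_le hS hSn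
      -- Either `Z₁` is rigid modulo a proper subgroup of `H`, or it contains two paths forming a
      -- gadget that enlarges `S`.
      by_cases hr1 : Rigid G γ (AddAction.stabilizer Γ S ⊓ H) Z₁
      · refine (hB _ (inf_le_right.lt_of_ne fun e => hH (inf_eq_right.1 e))
          (hst.subset fun x hx => hx.1) ?_ G Z₁ (hY.subset h1Y) hr1 hn1).mono h1Y
        exact ((Set.ncard_le_ncard (fun x hx => hx.1) hst).trans hst').trans (by omega)
      · simp only [Rigid, not_forall] at hr1
        obtain ⟨a, b, x, y, l, l', hx, hy, hxy⟩ := hr1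
        have hxyH : x - y ∈ H := hr _ _ _ _ _ _ (hx.mono h1Y le_rfl) (hy.mono h1Y le_rfl)
        have hxyS : x - y ∉ AddAction.stabilizer Γ S := fun h => hxy ⟨h, hxyH⟩
        have hab : a ≠ b := by
          rintro rfl
          obtain ⟨p, hp, -, rfl, -⟩ := hx
          obtain ⟨q, hq, -, rfl, -⟩ := hy
          have hp := Walk.isPath_iff_nil.1 hp
          have hq := Walk.isPath_iff_nil.1 hq
          rw [← Walk.eq_nil_iff_nil] at hp hq
          subst hp hq
          simp at hxyS
        have hLn := hL.insert_gadget (T := {x, y}) (m := 0) hL' hd subset_rfl hZ' h1 h2 hd' hab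
          (by
            rintro t (rfl | rfl)
            exacts [hx.mono (fun _ h => h) (Nat.zero_le _), hy.mono (fun _ h => h) (Nat.zero_le _)])
          (by simp)
        have hRn : R ∪ Z \ Z' ∪ Z₁ ⊆ Y :=
          Set.union_subset (Set.union_subset hR (Set.sdiff_subset.trans hZ)) h1Y
        have hdn : Disjoint (R ∪ Z \ Z' ∪ Z₁) Z₂ := by
          rw [Set.disjoint_union_left, Set.disjoint_union_left]
          exact ⟨⟨hd.mono_right (h2.trans hZ'), Set.disjoint_sdiff_left.mono_right h2⟩, hd'⟩
        have hlt := ncard_lt_ncard_add_pair hS hxyS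
        have hRZn : R ∪ Z \ Z' ∪ Z₁ ⊆ Y \ Z₂ :=
          fun x hx => ⟨hRn hx, Set.disjoint_left.1 hdn hx⟩
        exact ih hRn (h2.trans (hZ'.trans hZ)) hdn (hS.add (by simp)) (hSn.add (by simp))
          (hLn.mono_length (by omega)) (by omega) hn2 hRZn
          fun u v => Set.insert_subset_insert (Set.insert_subset_insert hRZn)

/-! ### Induction on the subgroup -/

/-- The number of classes needed modulo `H`, if `m` classes are needed modulo smaller subgroups. -/
def stepBound (ω d k m : ℕ) : ℕ :=
  (ω + 1) * (longBound d (growBound m k ω) + 1)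

lemma Bound.step {ω d k m : ℕ} (hA : Aᶜ.encard ≤ ω)
    (hB : ∀ H' < H, (H' : Set Γ).Finite → (H' : Set Γ).ncard ≤ ω → Bound (V := V) γ A d k H' m) :
    Bound (V := V) γ A d k H (stepBound ω d k m) := by
  intro G Y hY hr hP
  -- Edges whose doubled label is outside `H` lie on no cycle in `Y`, so discarding them does not
  -- affect the number of classes.
  let K : SimpleGraph V :=
    { Adj := fun a b => G.Adj a b ∧ γ s(a, b) + γ s(a, b) ∈ H
      symm := ⟨fun a b h => ⟨h.1.symm, by rw [Sym2.eq_swap]; exact h.2⟩⟩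
      loopless := ⟨fun _ h => h.1.ne rfl⟩ }
  have hK : K ≤ G := fun _ _ h => h.1
  have hrK := hr.mono_graph hK
  have hPK : ¬ Part K γ A Y (stepBound ω d k m) := by
    rintro ⟨c, hc, hC⟩
    refine hP ⟨c, hc, fun x C h1 h2 h3 => ?_⟩
    have he : ∀ e ∈ C.edges, e ∈ K.edgeSet := by
      intro e he
      have h4 := (hr.of_mem_cycle h1 h3 he).1
      induction e using Sym2.ind with
      | _ a b => exact ⟨C.adj_of_mem_edges he, h4⟩
    simpa using hC x (C.transfer K he) (h1.transfer he) (by simpa using h2) (by simpa using h3)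
  obtain ⟨Y', hY', hP', hm⟩ := hrK.exists_subset_meeting hA hY (fun a b h => h.2) hPK
  obtain ⟨R, Z, hR, hZ, hd, hn, hL⟩ := exists_long_linked (hY.subset hY') _ _ hP'
  obtain ⟨X, hX, hX1, hX2⟩ := (HasLinkedSet.of_linked hA (hY.subset hY') (hrK.mono hY') hm hB ω hR hZ
    hd (Set.finite_singleton 0) (Set.singleton_nonempty 0) hL (by simp) hn).mono hY'
  refine ⟨X, hX, ?_, fun u hu v hv huv => ?_⟩
  · rintro ⟨c, hc, hC⟩
    refine hX1 ⟨c, hc, fun x C h1 h2 h3 => ?_⟩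
    simpa using hC x (C.mapLe hK) ((Walk.isCycle_mapLe hK).2 h1) (by simpa using h2)
      (by simpa using h3)
  · obtain ⟨g, hg, hg'⟩ := hX2 u hu v hv huv
    exact ⟨g, hg, hg'.of_le hK⟩

lemma Bound.of_ncard_le {ω d k : ℕ} (hA : Aᶜ.encard ≤ ω) (h : ℕ) (hH : (H : Set Γ).Finite)
    (hh : (H : Set Γ).ncard ≤ h) : Bound (V := V) γ A d k H ((stepBound ω d k)^[h] 0) := by
  induction h generalizing H with
  | zero =>
    have := (Set.ncard_pos hH).2 ⟨0, H.zero_mem⟩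
    omega
  | succ h ih =>
    rw [Function.iterate_succ_apply']
    refine Bound.step hA fun H' hlt hfin _ => ih hfin ?_
    have := Set.ncard_lt_ncard (SetLike.coe_ssubset_coe.2 hlt) hH
    omega

/-- The number of classes that forces a linked subset. -/
def linkBound (ω d k : ℕ) : ℕ := stepBound ω d k ((stepBound ω d k)^[ω] 0)

/-- Every set is rigid modulo the whole group, which may be infinite; hence one extra step on top of
the induction over finite orders. -/
lemma hasLinkedSet {ω d k : ℕ} (hA : Aᶜ.encard ≤ ω) (hY : Y.Finite)
    (h : ¬ Part G γ A Y (linkBound ω d k)) : HasLinkedSet G γ A d k Y :=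
  Bound.step (H := ⊤) hA (fun _ _ hfin hle => Bound.of_ncard_le hA ω hfin hle) G Y hY
    (fun _ _ _ _ _ _ _ _ => AddSubgroup.mem_top _) h

/-! ### Nested links, the subdivision and arboricity -/

/-- Each step uses up the region `Y \ Y₁` and continues inside `Y₁`, so the regions are disjoint,
and links between vertices of `Y₁` remain available for the final `X`. -/
lemma exists_nested_links {ω d k : ℕ} (hA : Aᶜ.encard ≤ ω) (m : ℕ) (hY : Y.Finite)
    (h : ¬ Part G γ A Y ((linkBound ω d)^[m] k)) :
    ∃ X ⊆ Y, ¬ Part G γ A X k ∧ ∃ R : ℕ → Set V, (∀ n < m, R n ⊆ Y \ X) ∧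
      (∀ n < m, ∀ n' < m, n ≠ n' → Disjoint (R n) (R n')) ∧
      ∀ n < m, ∀ u ∈ X, ∀ v ∈ X, u ≠ v → ∃ g ∈ A, Route G γ (insert u (insert v (R n))) u v g d := by
  induction m generalizing Y with
  | zero => exact ⟨Y, subset_rfl, h, fun _ => ∅, by simp, by simp, by simp⟩
  | succ m ih =>
    rw [Function.iterate_succ_apply'] at h
    obtain ⟨Y₁, hY₁, hP, hlink⟩ := hasLinkedSet hA hY h
    obtain ⟨X, hX, hPX, R, hR, hd, hr⟩ := ih (hY.subset hY₁) hP
    have hdm : ∀ n < m, Disjoint (R n) (Y \ Y₁) := fun n hn =>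
      Set.disjoint_sdiff_right.mono_left ((hR n hn).trans Set.sdiff_subset)
    refine ⟨X, hX.trans hY₁, hPX, fun n => if n < m then R n else Y \ Y₁, ?_, ?_, ?_⟩
    · intro n _
      dsimp only
      split_ifs with hnm
      · exact (hR n hnm).trans (Set.sdiff_subset_sdiff_left hY₁)
      · exact Set.sdiff_subset_sdiff_right hX
    · intro n hn n' hn' hne
      dsimp only
      split_ifs with h1 h2 h2
      · exact hd n h1 n' h2 hne
      · exact hdm n h1
      · exact (hdm n' h2).symm
      · omega
    · intro n _ u hu v hv huv
      dsimp only
      split_ifs with hnm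
      · exact hr n hnm u hu v hv huv
      · exact hlink u (hX hu) v (hX hv) huv

lemma exists_subdivision {d t : ℕ} {X : Set V} {R : ℕ → Set V} (hX : t ≤ X.ncard)
    (hR : ∀ n < t * t, Disjoint (R n) X)
    (hd : ∀ n < t * t, ∀ n' < t * t, n ≠ n' → Disjoint (R n) (R n'))
    (hr : ∀ n < t * t, ∀ u ∈ X, ∀ v ∈ X, u ≠ v →
      ∃ g ∈ A, Route G γ (insert u (insert v (R n))) u v g d) :
    ∃ K : CompleteSubdivision G t, ∀ i j h, wt γ (K.path i j h) ∈ A ∧ d ≤ (K.path i j h).length := by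
  obtain ⟨s, hsX, hs⟩ := Set.exists_subset_card_eq hX
  obtain ⟨b, hb, hbX⟩ : ∃ b : Fin t → V, Function.Injective b ∧ ∀ i, b i ∈ X := by
    rcases Nat.eq_zero_or_pos t with rfl | ht
    · exact ⟨Fin.elim0, fun i => i.elim0, fun i => i.elim0⟩
    have := (Set.finite_of_ncard_pos (hs ▸ ht)).to_subtype
    let e := (Finite.equivFinOfCardEq (α := s) hs).symm
    exact ⟨fun i => e i, Subtype.val_injective.comp e.injective, fun i => hsX (e i).2⟩
  let code : Fin t × Fin t → Fin (t * t) := finProdFinEquiv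
  have hcode : Function.Injective code := finProdFinEquiv.injective
  have hpath : ∀ i j : Fin t, i < j → ∃ p : G.Walk (b i) (b j), p.IsPath ∧
      (∀ x ∈ p.support, x ∈ insert (b i) (insert (b j) (R (code (i, j))))) ∧ wt γ p ∈ A ∧
      d ≤ p.length := by
    intro i j hij
    obtain ⟨g, hg, p, h1, h2, h3, h4⟩ := hr (code (i, j)) (code (i, j)).2 _ (hbX i) _ (hbX j)
      (hb.ne hij.ne)
    exact ⟨p, h1, h2, h3 ▸ hg, h4⟩
  choose p hp1 hp2 hp3 hp4 using hpath
  refine ⟨⟨b, hb, p, hp1, ?_, ?_⟩, fun i j h => ⟨hp3 i j h, hp4 i j h⟩⟩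
  · intro i j h k hk
    rcases hp2 i j h _ hk with e | e | e
    · exact Or.inl (hb e)
    · exact Or.inr (hb e)
    · exact (Set.disjoint_left.1 (hR _ (code (i, j)).2) e (hbX k)).elim
  · intro i j h i' j' h' hne x hx hx'
    rcases hp2 i j h _ hx with e | e | e
    · exact ⟨i, e.symm⟩
    · exact ⟨j, e.symm⟩
    rcases hp2 i' j' h' _ hx' with e' | e' | e'
    · exact ⟨i', e'.symm⟩
    · exact ⟨j', e'.symm⟩
    exact (Set.disjoint_left.1 (hd _ (code (i, j)).2 _ (code (i', j')).2
      fun hc => hne (hcode (Fin.ext hc))) e e').elim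

open Classical in
/-- Extend a labelling of the edges by `0`. -/
noncomputable def extend (γ : G.edgeSet → Γ) (e : Sym2 V) : Γ :=
  if h : e ∈ G.edgeSet then γ ⟨e, h⟩ else 0

lemma value_eq_wt (γ : G.edgeSet → Γ) (p : G.Walk u v) : value γ p = wt (extend γ) p := by
  induction p with
  | nil => simp [value]
  | cons h p ih =>
    rw [value, wt_cons, ih, extend, dif_pos (G.mem_edgeSet.2 h)]

lemma arboricity_le_of_part (γ : G.edgeSet → Γ) {n : ℕ}
    (h : Part G (extend γ) A Set.univ n) : arboricity γ A ≤ n := by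
  obtain ⟨c, hc, hC⟩ := h
  refine iInf₂_le n ⟨fun x => ⟨c x, hc x trivial⟩, fun i x C h1 h2 h3 => ?_⟩
  obtain ⟨y, hy, hne⟩ := hC x C h1 (value_eq_wt γ C ▸ h3) fun _ _ => trivial
  have e1 : (⟨c y, _⟩ : Fin n) = i := h2 y hy
  have e2 : (⟨c x, _⟩ : Fin n) = i := h2 x C.start_mem_support
  exact hne (Fin.mk.inj (e1.trans e2.symm))

end LabelledGraph

theorem theorem1p1 (ω : ℕ) (hω : 0 < ω) :
    ∃ f : ℕ → ℕ → ℕ,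
      ∀ (Γ : Type*) [AddCommGroup Γ] (A : Set Γ), A.Nonempty → Aᶜ.encard ≤ (ω : ℕ∞) →
      ∀ (V : Type*) (G : SimpleGraph V) (γ : G.edgeSet → Γ) (t d : ℕ),
        (f t d : ℕ∞) ≤ LabelledGraph.arboricity γ A →
        ∃ K : LabelledGraph.CompleteSubdivision G t, K.IsAd γ A d := by
  open LabelledGraph in
  -- There is one linking step for each ordered pair of indices; a final set not splitting into `t`
  -- classes has more than `t` vertices. The `+ 1` turns the lower bound on arboricity into a
  -- failure to split.
  refine ⟨fun t d => (linkBound ω d)^[t * t] t + 1, fun Γ _ A _ hA V G γ t d harb => ?_⟩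
  obtain ⟨Y, hY⟩ : ∃ Y : Finset V, ¬ Part G (extend γ) A Y ((linkBound ω d)^[t * t] t) := by
    by_contra! hcon
    have h := harb.trans (arboricity_le_of_part γ (Part.of_finite hcon))
    rw [Nat.cast_le] at h
    exact (Nat.lt_succ_self _).not_ge h
  obtain ⟨X, hXY, hX, R, hR, hd, hr⟩ := exists_nested_links hA (t * t) Y.finite_toSet hY
  have hcard : t ≤ X.ncard := by
    by_contra! hlt
    exact hX ((Part.ncard (Y.finite_toSet.subset hXY)).mono subset_rfl hlt.le)
  obtain ⟨K, hK⟩ := exists_subdivision hcard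
    (fun n hn => Set.disjoint_sdiff_left.mono_left (hR n hn)) hd hr
  exact ⟨K, fun i j h => ⟨value_eq_wt γ (K.path i j h) ▸ (hK i j h).1, (hK i j h).2⟩⟩
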